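/- For an open set $\Omega\subset\mathbb R^3$ let $V(\Omega)$ be the space of divergence-free vector fields in $C_c^\infty(\Omega;\mathbb R^3)$, let $\mathcal H(\Omega)$ be the closure of $V(\Omega)$ in $L^2(\Omega;\mathbb R^3)$, and let $\mathbb P_\Omega:L^2(\Omega;\mathbb R^3)\to\mathcal H(\Omega)$ be the orthogonal (Leray) projection. A smooth obstacle is a compact set $K\subset\mathbb R^3$ with $C^\infty$ boundary (locally lying on one side of it) such that $\mathbb R^3\setminus K$ is simply connected. Let $\mathcal C\subset\mathbb R^3$ be a compact injective $C^2$ curve, i.e. $\mathcal C=\gamma([a,b])$ with $a<b$ and $\gamma:[a,b]\to\mathbb R^3$ injective, of class $C^2$ and with $\gamma'\neq0$ on $[a,b]$. Let $(\mathcal C_n)_{n\in\mathbb N}$ be smooth obstacles with $\mathcal C\subset\mathcal C_n$ for every $n$, whose Hausdorff distance to $\mathcal C$ tends to $0$, and put $\Omega_n=\mathbb R^3\setminus\mathcal C_n$. Let $\omega_0\in V(\mathbb R^3)$ and let \[ v_0(x)=-\int_{\mathbb R^3}\frac{x-y}{4\pi|x-y|^3}\times\omega_0(y)\,dy . \] Then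 $v_0\in L^2(\mathbb R^3)$ and, with $u_0^n:=\mathbb P_{\Omega_n}(v_0|_{\Omega_n})$ and $E$ the extension by zero from $\Omega_n$ to $\mathbb R^3$, \[ Eu_0^n\longrightarrow v_0\quad\text{strongly in }L^2(\mathbb R^3)\quad\text{as }n\to\infty . \] -/

import Mathlib

open MeasureTheory Filter Topology Set
open scoped ContDiff ENNReal

noncomputable section

namespace ThinObstacle

/-- Euclidean three-space. -/
abbrev E3 : Type := EuclideanSpace ℝ (Fin 3)

/-- The cross product on Euclidean three-space. -/
def cross (u v : E3) : E3 :=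
  WithLp.toLp 2 (crossProduct (WithLp.ofLp u) (WithLp.ofLp v))

/-- The divergence of a vector field. -/
def divergence (φ : E3 → E3) (x : E3) : ℝ :=
  ∑ i : Fin 3, (fderiv ℝ φ x (EuclideanSpace.single i 1)) i

/-- `V(Ω)`: smooth divergence free vector fields with compact support contained in `Ω`. -/
structure IsTestField (Ω : Set E3) (φ : E3 → E3) : Prop where
  contDiff : ContDiff ℝ ∞ φ
  hasCompactSupport : HasCompactSupport φ
  tsupport_subset : tsupport φ ⊆ Ω
  divergence_eq_zero : ∀ x, divergence φ x = 0

lemma IsTestField.zero (Ω : Set E3) : IsTestField Ω (fun _ => 0) where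
  contDiff := contDiff_const
  hasCompactSupport := HasCompactSupport.zero
  tsupport_subset := by
    have h : tsupport (fun _ : E3 => (0 : E3)) = ∅ := tsupport_eq_empty_iff.2 rfl
    rw [h]
    exact empty_subset _
  divergence_eq_zero x := by simp [divergence]

lemma IsTestField.add {Ω : Set E3} {φ ψ : E3 → E3} (hφ : IsTestField Ω φ)
    (hψ : IsTestField Ω ψ) : IsTestField Ω (φ + ψ) where
  contDiff := hφ.contDiff.add hψ.contDiff
  hasCompactSupport := hφ.hasCompactSupport.add hψ.hasCompactSupport
  tsupport_subset :=
    (tsupport_add φ ψ).trans (union_subset hφ.tsupport_subset hψ.tsupport_subset)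
  divergence_eq_zero x := by
    have h1 := hφ.divergence_eq_zero x
    have h2 := hψ.divergence_eq_zero x
    have d1 : DifferentiableAt ℝ φ x := hφ.contDiff.differentiable (by simp) x
    have d2 : DifferentiableAt ℝ ψ x := hψ.contDiff.differentiable (by simp) x
    simp only [divergence] at *
    rw [fderiv_add d1 d2]
    simp [Finset.sum_add_distrib, h1, h2]

lemma IsTestField.smul {Ω : Set E3} {φ : E3 → E3} (c : ℝ) (hφ : IsTestField Ω φ) :
    IsTestField Ω (c • φ) where
  contDiff := hφ.contDiff.const_smul c
  hasCompactSupport := hφ.hasCompactSupport.smul_left (f := fun _ => c)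
  tsupport_subset :=
    (tsupport_smul_subset_right (fun _ : E3 => c) φ).trans hφ.tsupport_subset
  divergence_eq_zero x := by
    have h1 := hφ.divergence_eq_zero x
    have d1 : DifferentiableAt ℝ φ x := hφ.contDiff.differentiable (by simp) x
    simp only [divergence] at *
    rw [fderiv_const_smul d1 c]
    simp [← Finset.mul_sum, h1]

/-- `L²(Ω)`, for vector fields. -/
abbrev L2Field (Ω : Set E3) : Type := Lp E3 2 (volume.restrict Ω)

/-- The image of `V(Ω)` in `L²(Ω)`. -/
def testFieldsL2 (Ω : Set E3) : Submodule ℝ (L2Field Ω) where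
  carrier := {f | ∃ φ : E3 → E3, IsTestField Ω φ ∧ f =ᵐ[volume.restrict Ω] φ}
  zero_mem' := ⟨_, IsTestField.zero Ω, Lp.coeFn_zero E3 2 (volume.restrict Ω)⟩
  add_mem' := by
    rintro f g ⟨φ, hφ, hf⟩ ⟨ψ, hψ, hg⟩
    exact ⟨_, hφ.add hψ, (Lp.coeFn_add f g).trans (hf.add hg)⟩
  smul_mem' := by
    rintro c f ⟨φ, hφ, hf⟩
    exact ⟨_, hφ.smul c, (Lp.coeFn_smul c f).trans (hf.const_smul c)⟩

/-- `𝓗(Ω)`: the closure of `V(Ω)` in the `L²` norm. -/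
def solenoidal (Ω : Set E3) : Submodule ℝ (L2Field Ω) :=
  (testFieldsL2 Ω).topologicalClosure

instance (Ω : Set E3) : CompleteSpace (solenoidal Ω) :=
  (testFieldsL2 Ω).isClosed_topologicalClosure.completeSpace_coe

/-- The Leray projection: the orthogonal projection of `L²(Ω)` onto `𝓗(Ω)`. -/
def lerayProjection (Ω : Set E3) : L2Field Ω →L[ℝ] solenoidal Ω :=
  (solenoidal Ω).orthogonalProjectionOnto

/-- The restriction to `Ω` of a square integrable field on the whole space. -/
def restrictL2 (Ω : Set E3) {v : E3 → E3} (hv : MemLp v 2 volume) : L2Field Ω :=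
  (hv.restrict Ω).toLp v

/-- The extension by zero outside `Ω`. -/
def extendByZero (Ω : Set E3) (f : L2Field Ω) : E3 → E3 :=
  Ω.indicator f

/-- The Biot–Savart field of a vorticity in the whole space. -/
def biotSavart (w : E3 → E3) (x : E3) : E3 :=
  -∫ y, cross ((1 / (4 * Real.pi * ‖x - y‖ ^ 3)) • (x - y)) (w y)

/-- A compact injective curve of class `C²`: the image of a compact interval under an
injective regular parametrization of class `C²`. -/
def IsInjectiveC2Curve (C : Set E3) : Prop :=
  ∃ (a b : ℝ) (γ : ℝ → E3), a < b ∧ ContDiffOn ℝ 2 γ (Icc a b) ∧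
    (∀ t ∈ Icc a b, derivWithin γ (Icc a b) t ≠ 0) ∧
    InjOn γ (Icc a b) ∧ C = γ '' Icc a b

/-- The closed set `K` has a smooth boundary: near each boundary point it is a sublevel set of
a smooth function with nonvanishing differential. -/
def HasSmoothBoundary (K : Set E3) : Prop :=
  ∀ x ∈ frontier K, ∃ U ∈ 𝓝 x, ∃ f : E3 → ℝ,
    ContDiff ℝ ∞ f ∧ fderiv ℝ f x ≠ 0 ∧ ∀ y ∈ U, (y ∈ K ↔ f y ≤ 0)

/-- A smooth obstacle: a compact set with smooth boundary and simply connected complement. -/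
structure IsSmoothObstacle (K : Set E3) : Prop where
  isCompact : IsCompact K
  isSimplyConnected_compl : IsSimplyConnected Kᶜ
  hasSmoothBoundary : HasSmoothBoundary K

end ThinObstacle

end

noncomputable section

namespace ThinObstacle

/-! The Biot–Savart field is `curl ψ`, where ψ is the Newtonian potential of `ω₀`. Since ψ =
O(1/(1+|x|)) and `curl ψ` = O(1/(1+|x|)²), the field is square integrable.

The heart of the matter is that `curl ψ` belongs to the solenoidal space of the complement of the
curve C (`restrictL2_curl_mem_solenoidal`). Tubes of radius r about C have volume O(r²), so a cutoff
with gradient O(1/r) on such a tube has gradient bounded in L². This is the critical case: the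
gradient need not tend to 0 in norm, but boundedness suffices. Take θₙ vanishing near C and near
infinity; the fields curl(θₙψ) are test fields off C, their differences from `curl ψ` are bounded in
L², and these differences are eventually zero at each point off C. They therefore tend weakly to 0,
and a closed subspace contains its weak limits.

Since C is a null set, some test field φ supported off C is as close as desired to the Biot–Savart
field v in L²(ℝ³). The support of φ is compact, so it misses the obstacles Kₙ for large n.
Projection is nearest-point approximation, so the error off Kₙ is at most ‖φ - v‖; on Kₙ both φ and
the extended projection vanish, so the error there equals that of φ. Altogether the error is at most
2‖φ - v‖. -/

open scoped Convolution

/-! ### Vector calculus of the curl. -/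

/-- The cross product as a continuous bilinear map. -/
def crossL : E3 →L[ℝ] E3 →L[ℝ] E3 :=
  (LinearMap.mk₂ ℝ cross
    (fun u v w => by simp [cross])
    (fun c u w => by simp [cross])
    (fun u v w => by simp [cross])
    (fun c u w => by simp [cross])).toContinuousBilinearMap

lemma crossL_apply (u v : E3) : crossL u v = cross u v := rfl

/-- The `i`-th vector of the standard basis. -/
abbrev basisVec (i : Fin 3) : E3 := EuclideanSpace.single i 1

/-- The curl of a vector field, `∑ i, e i × ∂ i ψ`. -/
def curl (ψ : E3 → E3) (x : E3) : E3 :=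
  ∑ i, crossL (basisVec i) (fderiv ℝ ψ x (basisVec i))

lemma contDiff_curl {ψ : E3 → E3} (hψ : ContDiff ℝ ∞ ψ) : ContDiff ℝ ∞ (curl ψ) := by
  have h : ContDiff ℝ ∞ (fderiv ℝ ψ) := hψ.fderiv_right (by simp)
  refine ContDiff.sum fun i _ => ?_
  exact (crossL (basisVec i)).contDiff.comp (h.clm_apply contDiff_const)

/-- Symmetry of the second derivative makes the mixed terms cancel in pairs. -/
lemma divergence_curl {ψ : E3 → E3} (hψ : ContDiff ℝ ∞ ψ) (x : E3) :
    divergence (curl ψ) x = 0 := by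
  have h : Differentiable ℝ (fderiv ℝ ψ) :=
    (hψ.fderiv_right (m := ∞) (by simp)).differentiable (by simp)
  have hs : IsSymmSndFDerivAt ℝ ψ x := hψ.contDiffAt.isSymmSndFDerivAt (by
    simpa using
      (WithTop.coe_le_coe.2 le_top : ((2 : ℕ∞) : WithTop ℕ∞) ≤ ((⊤ : ℕ∞) : WithTop ℕ∞)))
  have hd : ∀ v, fderiv ℝ (curl ψ) x v =
      ∑ i, crossL (basisVec i) (fderiv ℝ (fderiv ℝ ψ) x v (basisVec i)) := by
    intro v
    have : HasFDerivAt (curl ψ) (∑ i, (crossL (basisVec i)).comp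
        ((fderiv ℝ (fderiv ℝ ψ) x).flip (basisVec i))) x := by
      refine HasFDerivAt.fun_sum fun i _ => ?_
      have h1 := (h x).hasFDerivAt.clm_apply (hasFDerivAt_const (basisVec i) x)
      refine (crossL (basisVec i)).hasFDerivAt.comp x (h1.congr_fderiv ?_)
      ext w
      simp
    rw [this.fderiv]
    simp
  simp only [divergence, hd, Fin.sum_univ_three, crossL_apply, cross]
  have h01 := hs (basisVec 0) (basisVec 1)
  have h02 := hs (basisVec 0) (basisVec 2)
  have h12 := hs (basisVec 1) (basisVec 2)
  simp [crossProduct, h01, h02, h12]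
  ring

lemma curl_smul {θ : E3 → ℝ} {ψ : E3 → E3} {x : E3} (hθ : DifferentiableAt ℝ θ x)
    (hψ : DifferentiableAt ℝ ψ x) :
    curl (fun y => θ y • ψ y) x = θ x • curl ψ x +
      ∑ i, crossL (basisVec i) (fderiv ℝ θ x (basisVec i) • ψ x) := by
  simp only [curl, fderiv_fun_smul hθ hψ, Finset.smul_sum, ← Finset.sum_add_distrib]
  simp

/-- What remains of the product rule is ∇θ × ψ; the factor 3 counts the basis vectors, each of norm
one. -/
lemma norm_curl_smul_sub_le {θ : E3 → ℝ} {ψ : E3 → E3} {x : E3}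
    (hθ : DifferentiableAt ℝ θ x) (hψ : DifferentiableAt ℝ ψ x) :
    ‖curl (fun y => θ y • ψ y) x - θ x • curl ψ x‖ ≤
      3 * ‖crossL‖ * (‖fderiv ℝ θ x‖ * ‖ψ x‖) := by
  rw [curl_smul hθ hψ, add_sub_cancel_left]
  refine (norm_sum_le _ _).trans ?_
  have : ∀ i ∈ (Finset.univ : Finset (Fin 3)),
      ‖crossL (basisVec i) (fderiv ℝ θ x (basisVec i) • ψ x)‖
        ≤ ‖crossL‖ * (‖fderiv ℝ θ x‖ * ‖ψ x‖) := by
    intro i _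
    refine (crossL.le_opNorm₂ _ _).trans ?_
    rw [norm_smul]
    have h := (fderiv ℝ θ x).le_opNorm (basisVec i)
    have h1 : ‖basisVec i‖ = 1 := by simp
    rw [h1, mul_one] at h ⊢
    gcongr
  refine (Finset.sum_le_sum this).trans (le_of_eq ?_)
  simp
  ring

lemma tsupport_curl_subset (ψ : E3 → E3) : tsupport (curl ψ) ⊆ tsupport ψ := by
  refine closure_minimal (fun x hx => ?_) (isClosed_tsupport ψ)
  by_contra h
  refine hx ?_
  have : fderiv ℝ ψ x = 0 := by
    by_contra h'
    exact h (support_fderiv_subset ℝ h')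
  simp [curl, this]

lemma isTestField_curl {Ω : Set E3} {ψ : E3 → E3} (hψ : ContDiff ℝ ∞ ψ)
    (hc : HasCompactSupport ψ) (hs : tsupport ψ ⊆ Ω) : IsTestField Ω (curl ψ) where
  contDiff := contDiff_curl hψ
  hasCompactSupport := hc.mono' (subset_closure.trans (tsupport_curl_subset ψ))
  tsupport_subset := (tsupport_curl_subset ψ).trans hs
  divergence_eq_zero := divergence_curl hψ

/-! ### Singular kernels and integration by parts. -/

lemma locallyIntegrable_norm_inv : LocallyIntegrable (fun z : E3 => ‖z‖⁻¹) volume := by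
  refine locallyIntegrable_of_norm_le_rpow (C := 1) (α := 1) (by simp) (by simp)
    (ae_of_all _ fun z => ?_) (by fun_prop)
  simp [Real.rpow_neg_one]

lemma locallyIntegrable_norm_sq_inv : LocallyIntegrable (fun z : E3 => (‖z‖ ^ 2)⁻¹) volume := by
  refine locallyIntegrable_of_norm_le_rpow (C := 1) (α := 2) (by simp) (by simp; norm_num)
    (ae_of_all _ fun z => ?_) (by fun_prop)
  simp

/-- For ε > 0 the kernel has no singularity, so ordinary integration by parts applies; the singular
identity follows by letting ε tend to 0. -/
lemma integral_regularized_norm_inv_smul_fderiv {g : E3 → E3} (hg : ContDiff ℝ 1 g)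
    (hc : HasCompactSupport g) (v : E3) {ε : ℝ} (hε : 0 < ε) :
    ∫ z, (‖z‖ ^ 2 + ε) ^ (-(1 / 2) : ℝ) • fderiv ℝ g z v =
      ∫ z, ((‖z‖ ^ 2 + ε) ^ (-(3 / 2) : ℝ) * inner ℝ z v) • g z := by
  have hpos : ∀ z : E3, 0 < ‖z‖ ^ 2 + ε := fun z => by positivity
  have hk : ∀ z : E3, HasFDerivAt (fun z : E3 => (‖z‖ ^ 2 + ε) ^ (-(1 / 2) : ℝ))
      ((-(1 / 2) * (‖z‖ ^ 2 + ε) ^ (-(1 / 2) - 1 : ℝ)) • (2 • innerSL ℝ z)) z := fun z =>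
    (((hasStrictFDerivAt_norm_sq z).hasFDerivAt).add_const ε).rpow_const (Or.inl (hpos z).ne')
  have hk' : ∀ z : E3, fderiv ℝ (fun z : E3 => (‖z‖ ^ 2 + ε) ^ (-(1 / 2) : ℝ)) z v =
      -((‖z‖ ^ 2 + ε) ^ (-(3 / 2) : ℝ) * inner ℝ z v) := by
    intro z
    rw [(hk z).fderiv]
    have : (-(1 / 2) - 1 : ℝ) = -(3 / 2) := by norm_num
    simp only [this, smul_apply, innerSL_apply_apply, smul_eq_mul, nsmul_eq_mul,
      Nat.cast_ofNat]
    ring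
  have hcont : ∀ p : ℝ, Continuous fun z : E3 => (‖z‖ ^ 2 + ε) ^ p := fun p =>
    Continuous.rpow_const (by fun_prop) fun z => Or.inl (hpos z).ne'
  have hg' : Continuous fun z => fderiv ℝ g z v :=
    (hg.continuous_fderiv (by simp)).clm_apply continuous_const
  have key := integral_smul_fderiv_eq_neg_fderiv_smul_of_integrable (μ := volume)
    (f := fun z : E3 => (‖z‖ ^ 2 + ε) ^ (-(1 / 2) : ℝ)) (g := g) (v := v) ?_ ?_ ?_
    (fun z _ => (hk z).differentiableAt) (fun z _ => hg.differentiable (by simp) z)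
  · rw [key, ← integral_neg]
    simp only [hk', neg_smul, neg_neg]
  · simp only [hk']
    exact ((hcont _).mul (continuous_id.inner continuous_const)).neg.locallyIntegrable
      |>.integrable_smul_right_of_hasCompactSupport hg.continuous hc
  · exact (hcont _).locallyIntegrable.integrable_smul_right_of_hasCompactSupport hg'
      (hc.fderiv_apply ℝ v)
  · exact (hcont _).locallyIntegrable.integrable_smul_right_of_hasCompactSupport hg.continuous hc

lemma rpow_add_le_norm_pow {z : E3} (hz : z ≠ 0) {ε : ℝ} (hε : 0 < ε) (m : ℕ) :
    (‖z‖ ^ 2 + ε) ^ (-(m / 2) : ℝ) ≤ (‖z‖ ^ m)⁻¹ := by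
  have hz' : 0 < ‖z‖ := norm_pos_iff.2 hz
  have h1 : (‖z‖ ^ m)⁻¹ = (‖z‖ ^ 2) ^ (-(m / 2) : ℝ) := by
    rw [← Real.rpow_natCast ‖z‖ 2, ← Real.rpow_mul hz'.le, ← Real.rpow_natCast ‖z‖ m,
      ← Real.rpow_neg hz'.le]
    congr 1
    push_cast
    ring
  rw [h1]
  exact Real.rpow_le_rpow_of_nonpos (by positivity) (by linarith)
    (by have : (0 : ℝ) ≤ m := by positivity
        linarith)

lemma tendsto_rpow_add_norm_pow {z : E3} (hz : z ≠ 0) (m : ℕ) :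
    Tendsto (fun ε : ℝ => (‖z‖ ^ 2 + ε) ^ (-(m / 2) : ℝ)) (𝓝[>] 0) (𝓝 (‖z‖ ^ m)⁻¹) := by
  have hz' : 0 < ‖z‖ := norm_pos_iff.2 hz
  have h1 : (‖z‖ ^ m)⁻¹ = (‖z‖ ^ 2 + 0) ^ (-(m / 2) : ℝ) := by
    rw [add_zero, ← Real.rpow_natCast ‖z‖ 2, ← Real.rpow_mul hz'.le, ← Real.rpow_natCast ‖z‖ m,
      ← Real.rpow_neg hz'.le]
    congr 1
    push_cast
    ring
  rw [h1]
  refine tendsto_nhdsWithin_of_tendsto_nhds ?_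
  refine (ContinuousAt.rpow_const (by fun_prop) (Or.inl (by positivity))).tendsto

/-- Integration by parts against the kernel `1 / ‖z‖`, singular at the origin. -/
lemma integral_norm_inv_smul_fderiv {g : E3 → E3} (hg : ContDiff ℝ 1 g)
    (hc : HasCompactSupport g) (v : E3) :
    ∫ z, ‖z‖⁻¹ • fderiv ℝ g z v = ∫ z, ((‖z‖ ^ 3)⁻¹ * inner ℝ z v) • g z := by
  have hg' : Continuous fun z => fderiv ℝ g z v :=
    (hg.continuous_fderiv (by simp)).clm_apply continuous_const
  have hcont : ∀ p ε : ℝ, 0 < ε → Continuous fun z : E3 => (‖z‖ ^ 2 + ε) ^ p := fun p ε hε =>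
    Continuous.rpow_const (by fun_prop) fun z =>
      Or.inl (by positivity : 0 < ‖z‖ ^ 2 + ε).ne'
  have hne : ∀ᵐ z : E3, z ≠ 0 := by simp [ae_iff]
  have e1 : (-(1 / 2) : ℝ) = -((1 : ℕ) / 2) := by norm_num
  have e3 : (-(3 / 2) : ℝ) = -((3 : ℕ) / 2) := by norm_num
  have L1 : Tendsto (fun ε : ℝ => ∫ z : E3, (‖z‖ ^ 2 + ε) ^ (-(1 / 2) : ℝ) • fderiv ℝ g z v)
      (𝓝[>] 0) (𝓝 (∫ z, ‖z‖⁻¹ • fderiv ℝ g z v)) := by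
    refine tendsto_integral_filter_of_dominated_convergence
      (fun z => ‖‖z‖⁻¹ • fderiv ℝ g z v‖) ?_ ?_ ?_ ?_
    · filter_upwards [self_mem_nhdsWithin] with ε hε
      exact ((hcont _ ε hε).smul hg').aestronglyMeasurable
    · filter_upwards [self_mem_nhdsWithin] with ε hε
      filter_upwards [hne] with z hz
      have h := rpow_add_le_norm_pow hz hε 1
      rw [← e1, pow_one] at h
      rw [norm_smul, norm_smul, Real.norm_of_nonneg
        (Real.rpow_nonneg (by have := mem_Ioi.1 hε; positivity) _), norm_inv, norm_norm]
      gcongr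
    · exact (locallyIntegrable_norm_inv.integrable_smul_right_of_hasCompactSupport hg'
        (hc.fderiv_apply ℝ v)).norm
    · filter_upwards [hne] with z hz
      have h := tendsto_rpow_add_norm_pow hz 1
      rw [← e1, pow_one] at h
      exact h.smul_const _
  have L2 : Tendsto (fun ε : ℝ => ∫ z : E3, ((‖z‖ ^ 2 + ε) ^ (-(3 / 2) : ℝ) * inner ℝ z v) • g z)
      (𝓝[>] 0) (𝓝 (∫ z, ((‖z‖ ^ 3)⁻¹ * inner ℝ z v) • g z)) := by
    -- Cauchy–Schwarz on the inner product cancels one power: ‖z‖⁻³ · ‖z‖‖v‖ = ‖v‖‖z‖⁻², which is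
    -- locally integrable in dimension three.
    refine tendsto_integral_filter_of_dominated_convergence
      (fun z => ‖v‖ * ‖(‖z‖ ^ 2)⁻¹ • g z‖) ?_ ?_ ?_ ?_
    · filter_upwards [self_mem_nhdsWithin] with ε hε
      exact (((hcont _ ε hε).mul
        (continuous_id.inner continuous_const)).smul hg.continuous).aestronglyMeasurable
    · filter_upwards [self_mem_nhdsWithin] with ε hε
      filter_upwards [hne] with z hz
      have hz' : 0 < ‖z‖ := norm_pos_iff.2 hz
      have h := rpow_add_le_norm_pow hz hε 3
      rw [← e3] at h
      rw [norm_smul, norm_smul, norm_mul, Real.norm_of_nonneg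
        (Real.rpow_nonneg (by have := mem_Ioi.1 hε; positivity) _), norm_inv, norm_pow, norm_norm]
      have h2 : ‖(inner ℝ z v : ℝ)‖ ≤ ‖z‖ * ‖v‖ := norm_inner_le_norm z v
      calc _ ≤ (‖z‖ ^ 3)⁻¹ * (‖z‖ * ‖v‖) * ‖g z‖ := by gcongr
        _ = _ := by field_simp
    · exact (locallyIntegrable_norm_sq_inv.integrable_smul_right_of_hasCompactSupport
        hg.continuous hc).norm.const_mul _
    · filter_upwards [hne] with z hz
      have h := tendsto_rpow_add_norm_pow hz 3
      rw [← e3] at h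
      exact (h.mul_const _).smul_const _
  refine tendsto_nhds_unique L1 (L2.congr' ?_)
  filter_upwards [self_mem_nhdsWithin] with ε hε
  exact (integral_regularized_norm_inv_smul_fderiv hg hc v hε).symm

/-! ### The Newtonian potential and the decay of the Biot–Savart field. -/

/-- The Newtonian potential of a vector field, a vector potential for its Biot–Savart field. -/
def vectorPotential (w : E3 → E3) (x : E3) : E3 :=
  (4 * Real.pi)⁻¹ • ((fun z : E3 => ‖z‖⁻¹) ⋆[ContinuousLinearMap.lsmul ℝ ℝ, volume] w) x

lemma contDiff_vectorPotential {w : E3 → E3} (hw : ContDiff ℝ ∞ w) (hc : HasCompactSupport w) :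
    ContDiff ℝ ∞ (vectorPotential w) :=
  (hc.contDiff_convolution_right _ locallyIntegrable_norm_inv hw).const_smul _

/-- The derivative of the convolution first falls on `w`; integration by parts moves it to the
kernel, where it produces the Biot–Savart kernel. -/
lemma fderiv_vectorPotential {w : E3 → E3} (hw : ContDiff ℝ ∞ w) (hc : HasCompactSupport w)
    (x v : E3) : fderiv ℝ (vectorPotential w) x v =
      -∫ z, ((4 * Real.pi)⁻¹ * ((‖z‖ ^ 3)⁻¹ * inner ℝ z v)) • w (x - z) := by
  have hw1 : ContDiff ℝ 1 w := hw.of_le (by simp)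
  have h1 := (hc.hasFDerivAt_convolution_right (ContinuousLinearMap.lsmul ℝ ℝ)
    locallyIntegrable_norm_inv hw1 x).const_smul (4 * Real.pi)⁻¹
  have hg : ContDiff ℝ 1 fun z => w (x - z) := hw1.comp (contDiff_const.sub contDiff_id)
  have hgc : HasCompactSupport fun z => w (x - z) :=
    hc.comp_homeomorph (Homeomorph.subLeft x)
  have hfd : ∀ z, fderiv ℝ (fun z => w (x - z)) z v = -fderiv ℝ w (x - z) v := by
    intro z
    have h2 : HasFDerivAt (fun z => w (x - z)) ((fderiv ℝ w (x - z)).comp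
        (-ContinuousLinearMap.id ℝ E3)) z :=
      (hw1.differentiable (by simp) (x - z)).hasFDerivAt.comp z
        ((hasFDerivAt_id z).const_sub x)
    rw [h2.fderiv]
    simp
  have h3 := integral_norm_inv_smul_fderiv hg hgc v
  simp only [hfd, smul_neg, integral_neg] at h3
  have h4 : fderiv ℝ (vectorPotential w) x = _ := h1.fderiv
  rw [h4, smul_apply, convolution_precompR_apply _ locallyIntegrable_norm_inv
    (hc.fderiv ℝ) (hw1.continuous_fderiv (by simp)), convolution_lsmul]
  simp only [mul_smul (4 * Real.pi)⁻¹, integral_smul]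
  rw [← h3, smul_neg, neg_neg]

lemma integrable_kernel_smul {w : E3 → E3} (hw : Continuous w) (hc : HasCompactSupport w)
    (x v : E3) :
    Integrable fun z => ((4 * Real.pi)⁻¹ * ((‖z‖ ^ 3)⁻¹ * inner ℝ z v)) • w (x - z) := by
  have hgc : HasCompactSupport fun z => w (x - z) :=
    hc.comp_homeomorph (Homeomorph.subLeft x)
  refine LocallyIntegrable.integrable_smul_right_of_hasCompactSupport ?_ (by fun_prop) hgc
  refine locallyIntegrable_of_norm_le_rpow (C := ‖(4 * Real.pi)⁻¹‖ * ‖v‖) (α := 2) (by simp)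
    (by simp; norm_num) (ae_of_all _ fun z => ?_) (by fun_prop)
  rw [norm_mul, mul_assoc, norm_mul]
  refine mul_le_mul_of_nonneg_left ?_ (norm_nonneg _)
  rcases eq_or_ne z 0 with rfl | hz
  · simp
  have hz' : 0 < ‖z‖ := norm_pos_iff.2 hz
  have h2 : ‖(inner ℝ z v : ℝ)‖ ≤ ‖z‖ * ‖v‖ := norm_inner_le_norm z v
  rw [Real.rpow_neg hz'.le, Real.rpow_ofNat, norm_inv, norm_pow, norm_norm]
  calc _ ≤ (‖z‖ ^ 3)⁻¹ * (‖z‖ * ‖v‖) := by gcongr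
    _ = _ := by field_simp

/-- After the substitution z = x - y, expanding z in the standard basis turns z × w into ∑ᵢ ⟨z, eᵢ⟩
eᵢ × w, which is the curl of the potential term by term. -/
lemma curl_vectorPotential {w : E3 → E3} (hw : ContDiff ℝ ∞ w) (hc : HasCompactSupport w) :
    curl (vectorPotential w) = biotSavart w := by
  ext1 x
  have hint := integrable_kernel_smul hw.continuous hc x
  have h1 : biotSavart w x =
      -∫ z, cross ((1 / (4 * Real.pi * ‖z‖ ^ 3)) • z) (w (x - z)) := by
    rw [biotSavart, ← integral_sub_left_eq_self
      (fun y => cross ((1 / (4 * Real.pi * ‖x - y‖ ^ 3)) • (x - y)) (w y)) volume x]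
    simp only [sub_sub_cancel]
  have h2 : ∀ z : E3, cross ((1 / (4 * Real.pi * ‖z‖ ^ 3)) • z) (w (x - z)) =
      ∑ i, crossL (basisVec i)
        (((4 * Real.pi)⁻¹ * ((‖z‖ ^ 3)⁻¹ * inner ℝ z (basisVec i))) • w (x - z)) := by
    intro z
    have hz : z = ∑ i, (inner ℝ z (basisVec i) : ℝ) • basisVec i := by
      have := (EuclideanSpace.basisFun (Fin 3) ℝ).sum_repr' z
      simp only [EuclideanSpace.basisFun_apply] at this
      conv_lhs => rw [← this]
      simp only [real_inner_comm]
    rw [← crossL_apply]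
    conv_lhs => rw [map_smul]; enter [1, 2]; rw [hz]
    simp only [map_sum, map_smul, sum_apply, smul_apply,
      Finset.smul_sum, smul_smul]
    refine Finset.sum_congr rfl fun i _ => ?_
    congr 1
    rw [one_div, mul_inv]
    ring
  rw [h1]
  simp only [h2]
  rw [integral_finsetSum _ fun i _ => (crossL (basisVec i)).integrable_comp (hint _)]
  simp only [curl, fderiv_vectorPotential hw hc, map_neg, Finset.sum_neg_distrib]
  congr 1
  refine Finset.sum_congr rfl fun i _ => ?_
  rw [← ContinuousLinearMap.integral_comp_comm _ (hint _)]

/-- Far from the support of `w` the kernel is comparable to its value at distance 1 + ‖x‖; on the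
remaining compact ball continuity gives a bound. -/
lemma exists_integral_decay_bound {w : E3 → E3} (hw : Continuous w) (hc : HasCompactSupport w)
    {m : ℕ} {c : ℝ} (hc0 : 0 ≤ c) {Φ : E3 → E3 → E3}
    (hΦ : ∀ x y, ‖Φ x y‖ ≤ c * (‖x - y‖ ^ m)⁻¹ * ‖w y‖)
    (hcont : Continuous fun x => ∫ y, Φ x y) :
    ∃ B, 0 ≤ B ∧ ∀ x, ‖∫ y, Φ x y‖ ≤ B * ((1 + ‖x‖) ^ m)⁻¹ := by
  obtain ⟨R₀, hR₀, hR⟩ := hc.isBounded.exists_pos_norm_le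
  set R := max R₀ 1
  have hR1 : 1 ≤ R := le_max_right _ _
  have hsupp : ∀ y, w y ≠ 0 → ‖y‖ ≤ R := fun y hy =>
    (hR y (subset_tsupport w hy)).trans (le_max_left _ _)
  obtain ⟨B₀, hB₀⟩ := (isCompact_closedBall (0 : E3) (2 * R)).exists_bound_of_continuousOn
    hcont.continuousOn
  have hB₀' : 0 ≤ B₀ := (norm_nonneg _).trans (hB₀ 0 (by simp; linarith))
  have hwi : Integrable fun y => ‖w y‖ := (hw.integrable_of_hasCompactSupport hc).norm
  have hI : 0 ≤ ∫ y, ‖w y‖ := integral_nonneg fun y => norm_nonneg _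
  refine ⟨c * 4 ^ m * (∫ y, ‖w y‖) + B₀ * (1 + 2 * R) ^ m, by positivity, fun x => ?_⟩
  rw [add_mul]
  rcases le_or_gt ‖x‖ (2 * R) with hx | hx
  · have h1 := hB₀ x (by simpa using hx)
    have h2 : 1 ≤ (1 + 2 * R) ^ m * ((1 + ‖x‖) ^ m)⁻¹ := by
      rw [← div_eq_mul_inv, one_le_div (by positivity)]
      gcongr
    have h3 : 0 ≤ c * 4 ^ m * (∫ y, ‖w y‖) * ((1 + ‖x‖) ^ m)⁻¹ := by positivity
    nlinarith
  · have h1 : ∀ y, ‖Φ x y‖ ≤ c * 4 ^ m * ((1 + ‖x‖) ^ m)⁻¹ * ‖w y‖ := by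
      intro y
      refine (hΦ x y).trans ?_
      rcases eq_or_ne (w y) 0 with hy | hy
      · simp [hy]
      have h2 := hsupp y hy
      have h3 : ‖x‖ ≤ ‖x - y‖ + ‖y‖ := by simpa using norm_add_le (x - y) y
      -- Here ‖y‖ ≤ R < ‖x‖/2, and R ≥ 1 absorbs the summand 1.
      have h4 : (1 + ‖x‖) / 4 ≤ ‖x - y‖ := by linarith
      have h5 : (‖x - y‖ ^ m)⁻¹ ≤ 4 ^ m * ((1 + ‖x‖) ^ m)⁻¹ := by
        calc (‖x - y‖ ^ m)⁻¹ ≤ (((1 + ‖x‖) / 4) ^ m)⁻¹ := by gcongr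
          _ = _ := by rw [div_pow, inv_div, div_eq_mul_inv]
      calc c * (‖x - y‖ ^ m)⁻¹ * ‖w y‖ ≤ c * (4 ^ m * ((1 + ‖x‖) ^ m)⁻¹) * ‖w y‖ := by gcongr
        _ = _ := by ring
    have h2 := norm_integral_le_of_norm_le (hwi.const_mul _) (ae_of_all _ h1)
    rw [integral_const_mul] at h2
    have h3 : 0 ≤ B₀ * (1 + 2 * R) ^ m * ((1 + ‖x‖) ^ m)⁻¹ := by positivity
    linarith

lemma exists_vectorPotential_bound {w : E3 → E3} (hw : ContDiff ℝ ∞ w)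
    (hc : HasCompactSupport w) :
    ∃ B, 0 ≤ B ∧ ∀ x, ‖vectorPotential w x‖ ≤ B * (1 + ‖x‖)⁻¹ := by
  have h : vectorPotential w = fun x => ∫ y, (4 * Real.pi)⁻¹ • ‖x - y‖⁻¹ • w y := by
    ext1 x
    rw [vectorPotential, convolution_lsmul_swap, integral_smul]
  have hcont := (contDiff_vectorPotential hw hc).continuous
  rw [h] at hcont ⊢
  simpa only [pow_one] using exists_integral_decay_bound hw.continuous hc (m := 1)
    (c := (4 * Real.pi)⁻¹) (by positivity)
    (fun x y => le_of_eq (by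
      rw [norm_smul, norm_smul, Real.norm_of_nonneg (by positivity), norm_inv, norm_norm]
      ring)) hcont

lemma exists_biotSavart_bound {w : E3 → E3} (hw : ContDiff ℝ ∞ w)
    (hc : HasCompactSupport w) :
    ∃ B, 0 ≤ B ∧ ∀ x, ‖biotSavart w x‖ ≤ B * ((1 + ‖x‖) ^ 2)⁻¹ := by
  have h : biotSavart w = fun x => ∫ y,
      -crossL ((1 / (4 * Real.pi * ‖x - y‖ ^ 3)) • (x - y)) (w y) := by
    ext1 x
    rw [biotSavart, integral_neg]
    rfl
  have hcont : Continuous (biotSavart w) := by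
    rw [← curl_vectorPotential hw hc]
    exact (contDiff_curl (contDiff_vectorPotential hw hc)).continuous
  rw [h] at hcont ⊢
  refine exists_integral_decay_bound hw.continuous hc
    (c := ‖crossL‖ * (4 * Real.pi)⁻¹) (by positivity) (fun x y => ?_) hcont
  rw [norm_neg]
  have h1 : ‖(1 / (4 * Real.pi * ‖x - y‖ ^ 3)) • (x - y)‖ =
      (4 * Real.pi)⁻¹ * (‖x - y‖ ^ 2)⁻¹ := by
    rw [norm_smul, Real.norm_of_nonneg (by positivity)]
    rcases eq_or_ne (x - y) 0 with hz | hz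
    · simp [hz]
    have hz' : 0 < ‖x - y‖ := norm_pos_iff.2 hz
    field_simp
  refine (crossL.le_opNorm₂ _ _).trans (le_of_eq ?_)
  rw [h1]
  ring

/-- The square decays with exponent 4, which exceeds the dimension 3. -/
lemma memLp_biotSavart {w : E3 → E3} (hw : ContDiff ℝ ∞ w) (hc : HasCompactSupport w) :
    MemLp (biotSavart w) 2 volume := by
  obtain ⟨B, hB, h⟩ := exists_biotSavart_bound hw hc
  have hcont : Continuous (biotSavart w) := by
    rw [← curl_vectorPotential hw hc]
    exact (contDiff_curl (contDiff_vectorPotential hw hc)).continuous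
  rw [memLp_two_iff_integrable_sq_norm hcont.aestronglyMeasurable]
  have hi : Integrable fun x : E3 => B ^ 2 * (1 + ‖x‖) ^ (-4 : ℝ) :=
    (integrable_one_add_norm (by simp; norm_num)).const_mul _
  refine hi.mono' (by fun_prop) (ae_of_all _ fun x => ?_)
  rw [Real.norm_of_nonneg (by positivity), Real.rpow_neg (by positivity)]
  norm_cast
  calc ‖biotSavart w x‖ ^ 2 ≤ (B * ((1 + ‖x‖) ^ 2)⁻¹) ^ 2 := by gcongr; exact h x
    _ = _ := by rw [mul_pow, inv_pow, ← pow_mul]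

/-! ### Cutoffs and the volume of tubes. -/

set_option maxSynthPendingDepth 3 in
/-- Smooth cutoffs between the thickenings of a set at radii `r` and `3 * r`, with gradient of
order `1 / r` uniformly in the set. -/
lemma exists_smooth_cutoff (E : Type*) [NormedAddCommGroup E] [InnerProductSpace ℝ E]
    [FiniteDimensional ℝ E] : ∃ M : ℝ, 0 ≤ M ∧ ∀ (S : Set E) (r : ℝ), 0 < r →
    ∃ η : E → ℝ, ContDiff ℝ ∞ η ∧ (∀ x, 0 ≤ η x) ∧ (∀ x, η x ≤ 1) ∧
      (∀ x ∈ Metric.thickening r S, η x = 1) ∧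
      (∀ x ∉ Metric.thickening (3 * r) S, η x = 0) ∧ ∀ x, ‖fderiv ℝ η x‖ ≤ M / r := by
  borelize E
  let μ : Measure E := Measure.addHaar
  let b : ContDiffBump (0 : E) := ⟨1 / 2, 1, by norm_num, by norm_num⟩
  let ρ : E → ℝ := b.normed μ
  have hρ : ContDiff ℝ ∞ ρ := b.contDiff_normed
  have hρc : HasCompactSupport ρ := b.hasCompactSupport_normed
  have hρi : Integrable ρ μ := hρ.continuous.integrable_of_hasCompactSupport hρc
  let L : ℝ →L[ℝ] ℝ →L[ℝ] ℝ := ContinuousLinearMap.lsmul ℝ ℝ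
  refine ⟨‖L.precompL E‖ * ∫ t, ‖fderiv ℝ ρ t‖ ∂μ, by positivity, fun S r hr => ?_⟩
  -- In the variable z = x / r, the indicator of the 2r-thickening is mollified by one fixed bump
  -- supported in the unit ball. Back in x the averaging radius is r, hence the radii r and 3r, and
  -- the chain rule gives the factor 1 / r with a constant depending only on the bump.
  let A : Set E := (fun z => r • z) ⁻¹' Metric.thickening (2 * r) S
  have hA : MeasurableSet A :=
    (Metric.isOpen_thickening.preimage (continuous_const_smul r)).measurableSet
  let g : E → ℝ := A.indicator fun _ => 1
  have hg0 : ∀ z, 0 ≤ g z := fun z => indicator_nonneg (fun _ _ => zero_le_one) z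
  have hg1 : ∀ z, g z ≤ 1 := fun z => indicator_le_self' (fun _ _ => zero_le_one) z
  have hgl : LocallyIntegrable g μ := (locallyIntegrable_const 1).indicator hA
  let ζ : E → ℝ := ρ ⋆[L, μ] g
  have hζ : ContDiff ℝ ∞ ζ := hρc.contDiff_convolution_left L hρ hgl
  have hζ0 : ∀ z, 0 ≤ ζ z := fun z =>
    integral_nonneg fun t => mul_nonneg (b.nonneg_normed t) (hg0 _)
  have hζ1 : ∀ z, ζ z ≤ 1 := by
    intro z
    rw [← b.integral_normed (μ := μ)]
    refine integral_mono_of_nonneg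
      (ae_of_all _ fun t => mul_nonneg (b.nonneg_normed t) (hg0 _)) hρi (ae_of_all _ fun t => ?_)
    exact mul_le_of_le_one_right (b.nonneg_normed t) (hg1 _)
  have hζd : ∀ z, ‖fderiv ℝ ζ z‖ ≤ ‖L.precompL E‖ * ∫ t, ‖fderiv ℝ ρ t‖ ∂μ := by
    intro z
    rw [(hρc.hasFDerivAt_convolution_left L (hρ.of_le (by simp)) hgl z).fderiv,
      ← integral_const_mul]
    refine norm_integral_le_of_norm_le ?_ (ae_of_all _ fun t => ?_)
    · exact (((hρ.continuous_fderiv (by simp)).integrable_of_hasCompactSupport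
        (hρc.fderiv ℝ)).norm).const_mul _
    · refine ((L.precompL E).le_opNorm₂ _ _).trans ?_
      refine mul_le_of_le_one_right (by positivity) ?_
      rw [Real.norm_of_nonneg (hg0 _)]
      exact hg1 _
  have hdist : ∀ x z : E, z ∈ Metric.ball (r⁻¹ • x) 1 → dist (r • z) x < r := by
    intro x z hz
    rw [Metric.mem_ball] at hz
    have : dist (r • z) (r • r⁻¹ • x) = r * dist z (r⁻¹ • x) := by
      rw [dist_smul₀, Real.norm_of_nonneg hr.le]
    rw [smul_inv_smul₀ hr.ne'] at this
    rw [this]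
    nlinarith
  have hconst : ∀ x : E, (∀ z ∈ Metric.ball (r⁻¹ • x) 1, g z = g (r⁻¹ • x)) →
      ζ (r⁻¹ • x) = g (r⁻¹ • x) := fun x hx =>
    ContDiffBump.normed_convolution_eq_right (φ := b) hx
  refine ⟨fun x => ζ (r⁻¹ • x), hζ.comp (contDiff_const_smul _), fun x => hζ0 _, fun x => hζ1 _,
    fun x hx => ?_, fun x hx => ?_, fun x => ?_⟩
  · have hz : ∀ z ∈ Metric.ball (r⁻¹ • x) 1, g z = 1 := by
      intro z hz
      refine indicator_of_mem (s := A) ?_ _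
      obtain ⟨s, hs, hxs⟩ := Metric.mem_thickening_iff.1 hx
      refine Metric.mem_thickening_iff.2 ⟨s, hs, ?_⟩
      have := dist_triangle (r • z) x s
      have := hdist x z hz
      linarith
    have hx' := hz _ (Metric.mem_ball_self one_pos)
    simp only
    rw [hconst x fun z h => (hz z h).trans hx'.symm, hx']
  · have hz : ∀ z ∈ Metric.ball (r⁻¹ • x) 1, g z = 0 := by
      intro z hz
      refine indicator_of_notMem (s := A) (fun h => hx ?_) _
      obtain ⟨s, hs, hxs⟩ := Metric.mem_thickening_iff.1 h
      refine Metric.mem_thickening_iff.2 ⟨s, hs, ?_⟩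
      have := dist_triangle_left x s (r • z)
      have := hdist x z hz
      linarith
    have hx' := hz _ (Metric.mem_ball_self one_pos)
    simp only
    rw [hconst x fun z h => (hz z h).trans hx'.symm, hx']
  · rw [fderiv_comp_smul, norm_smul, norm_inv, Real.norm_of_nonneg hr.le, div_eq_inv_mul]
    gcongr
    exact hζd _

/-- About (b - a) / r balls of radius O(r), centred at equally spaced parameters, cover the tube,
and r⁻¹ · r³ = r². The radius (L + 3)r adds the Lipschitz displacement over a parameter step r to
the tube radius 3r. -/
lemma exists_volume_thickening_le {a b : ℝ} (hab : a < b) {γ : ℝ → E3} {L : NNReal}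
    (hγ : LipschitzOnWith L γ (Icc a b)) :
    ∃ D : ℝ, 0 ≤ D ∧ ∀ r : ℝ, 0 < r → r ≤ 1 →
      volume (Metric.thickening (3 * r) (γ '' Icc a b)) ≤ ENNReal.ofReal (D * r ^ 2) := by
  set V : ℝ := volume.real (Metric.ball (0 : E3) 1) with hV
  refine ⟨(b - a + 1) * ((L + 3) ^ 3 * V), ?_, fun r hr hr1 => ?_⟩
  · have : 0 ≤ b - a + 1 := by linarith
    positivity
  set N : ℕ := ⌊(b - a) / r⌋₊
  have hsub : Metric.thickening (3 * r) (γ '' Icc a b) ⊆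
      ⋃ i ∈ Finset.range (N + 1), Metric.ball (γ (a + i * r)) ((L + 3) * r) := by
    intro x hx
    obtain ⟨_, ⟨t, ht, rfl⟩, hxt⟩ := Metric.mem_thickening_iff.1 hx
    have h0 : 0 ≤ (t - a) / r := div_nonneg (by linarith [ht.1]) hr.le
    have hi1 : (⌊(t - a) / r⌋₊ : ℝ) * r ≤ t - a := by
      rw [← le_div_iff₀ hr]
      exact Nat.floor_le h0
    have hi2 : t - a < (⌊(t - a) / r⌋₊ + 1 : ℝ) * r := by
      rw [← div_lt_iff₀ hr]
      exact Nat.lt_floor_add_one _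
    have hi3 : 0 ≤ (⌊(t - a) / r⌋₊ : ℝ) * r := by positivity
    simp only [mem_iUnion, Finset.mem_range, Metric.mem_ball]
    refine ⟨⌊(t - a) / r⌋₊, Nat.lt_succ_of_le (Nat.floor_le_floor ?_), ?_⟩
    · gcongr
      exact ht.2
    have h1 := hγ.dist_le_mul t ht (a + ⌊(t - a) / r⌋₊ * r) ⟨by linarith, by linarith [ht.2]⟩
    have h2 : dist t (a + ⌊(t - a) / r⌋₊ * r) ≤ r := by
      rw [Real.dist_eq, abs_le]
      constructor <;> linarith
    have h3 := mul_le_mul_of_nonneg_left h2 L.coe_nonneg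
    have h4 := dist_triangle x (γ t) (γ (a + ⌊(t - a) / r⌋₊ * r))
    linarith
  have hball : ∀ i : ℕ, volume (Metric.ball (γ (a + i * r)) ((L + 3) * r)) =
      ENNReal.ofReal (((L + 3) * r) ^ 3 * V) := by
    intro i
    rw [Measure.addHaar_ball volume _ (by positivity), finrank_euclideanSpace_fin,
      ENNReal.ofReal_mul (by positivity), hV, Measure.real, ENNReal.ofReal_toReal
        measure_ball_lt_top.ne]
  refine (measure_mono hsub).trans ((measure_biUnion_finset_le _ _).trans ?_)
  simp only [hball, Finset.sum_const, Finset.card_range, nsmul_eq_mul]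
  rw [← ENNReal.ofReal_natCast, ← ENNReal.ofReal_mul (by positivity)]
  refine ENNReal.ofReal_le_ofReal ?_
  have hN : (N : ℝ) * r ≤ b - a := by
    rw [← le_div_iff₀ hr]
    exact Nat.floor_le (div_nonneg (by linarith) hr.le)
  have h1 : ((N + 1 : ℕ) : ℝ) * r ≤ b - a + 1 := by
    push_cast
    linarith
  calc ((N + 1 : ℕ) : ℝ) * (((L + 3) * r) ^ 3 * V)
      = (((N + 1 : ℕ) : ℝ) * r) * (((L : ℝ) + 3) ^ 3 * V * r ^ 2) := by ring
    _ ≤ (b - a + 1) * (((L : ℝ) + 3) ^ 3 * V * r ^ 2) := by gcongr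
    _ = _ := by ring

lemma eLpNorm_two_le_of_le_indicator {f : E3 → ℝ} {s : Set E3} (hs : MeasurableSet s) {c D : ℝ}
    (hc : 0 ≤ c) (hf : ∀ x, ‖f x‖ ≤ s.indicator (fun _ => c) x)
    (hD : volume s ≤ ENNReal.ofReal D) :
    eLpNorm f 2 volume ≤ ENNReal.ofReal (c * √D) := by
  refine (eLpNorm_mono_real hf).trans ?_
  rw [eLpNorm_indicator_const hs (by simp) (by simp), ENNReal.ofReal_mul hc,
    Real.enorm_of_nonneg hc]
  gcongr
  -- For negative `D` the hypothesis forces `s` to be null, in accordance with `√D = 0`.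
  rcases le_or_gt 0 D with h | h
  · rw [Real.sqrt_eq_rpow, ← ENNReal.ofReal_rpow_of_nonneg h (by norm_num)]
    simp only [ENNReal.toReal_ofNat]
    gcongr
  · rw [ENNReal.ofReal_of_nonpos h.le, nonpos_iff_eq_zero] at hD
    simp [hD]

/-- A set is thin if the volume of its tubular neighbourhoods is at most quadratic in the
radius. -/
def IsThin (C : Set E3) : Prop :=
  ∃ D : ℝ, 0 ≤ D ∧ ∀ r : ℝ, 0 < r → r ≤ 1 →
    volume (Metric.thickening (3 * r) C) ≤ ENNReal.ofReal (D * r ^ 2)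

lemma IsThin.volume_eq_zero {C : Set E3} (hC : IsThin C) : volume C = 0 := by
  obtain ⟨D, -, h⟩ := hC
  have h1 : Tendsto (fun r : ℝ => ENNReal.ofReal (D * r ^ 2)) (𝓝[>] 0) (𝓝 0) := by
    have : Tendsto (fun r : ℝ => D * r ^ 2) (𝓝 0) (𝓝 (D * 0 ^ 2)) :=
      (by fun_prop : Continuous fun r : ℝ => D * r ^ 2).tendsto 0
    simpa using ENNReal.tendsto_ofReal (tendsto_nhdsWithin_of_tendsto_nhds this)
  refine le_antisymm (ge_of_tendsto h1 ?_) zero_le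
  filter_upwards [Ioc_mem_nhdsGT one_pos] with r hr
  exact (measure_mono (Metric.self_subset_thickening (by linarith [hr.1]) C)).trans
    (h r hr.1 hr.2)

/-- Take θₙ = χₙ(1 - ηₙ), with χₙ a cutoff about the origin at scale n + 1 and ηₙ a cutoff about C
at scale 1/(n + 1). -/
lemma exists_cutoffs_avoiding (C : Set E3) (hC : IsClosed C) :
    ∃ M : ℝ, 0 ≤ M ∧ ∃ θ : ℕ → E3 → ℝ, (∀ n, ContDiff ℝ ∞ (θ n)) ∧
      (∀ n, HasCompactSupport (θ n)) ∧ (∀ n, tsupport (θ n) ⊆ Cᶜ) ∧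
      (∀ n x, 0 ≤ θ n x ∧ θ n x ≤ 1) ∧
      (∀ n x, ‖fderiv ℝ (θ n) x‖ ≤
        (Metric.ball 0 (3 * (n + 1)) \ Metric.ball (0 : E3) (n + 1)).indicator
          (fun _ => M / (n + 1)) x +
        (Metric.thickening (3 * (1 / (n + 1))) C).indicator (fun _ => M / (1 / (n + 1))) x) ∧
      ∀ x ∉ C, ∀ᶠ n in atTop, θ n x = 1 ∧ fderiv ℝ (θ n) x = 0 := by
  obtain ⟨M, hM, hcut⟩ := exists_smooth_cutoff E3
  have hpos : ∀ n : ℕ, (0 : ℝ) < n + 1 := fun n => by positivity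
  choose χ hχ χ0 χ1 χone χzero χd using fun n : ℕ => hcut {(0 : E3)} (n + 1) (hpos n)
  choose η hη η0 η1 ηone ηzero ηd using
    fun n : ℕ => hcut C (1 / (n + 1)) (one_div_pos.2 (hpos n))
  simp only [Metric.thickening_singleton] at χone χzero
  have χfz : ∀ (n : ℕ) x, x ∉ (Metric.ball 0 (3 * (n + 1)) \ Metric.ball (0 : E3) (n + 1)) →
      fderiv ℝ (χ n) x = 0 := by
    intro n x hx
    by_cases h : x ∈ Metric.ball (0 : E3) (n + 1)
    -- The values 1 and 0 are extreme for χₙ, so its gradient vanishes wherever they are attained,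
    -- even on the edge of the region.
    · refine IsLocalMax.fderiv_eq_zero (Eventually.of_forall fun y => ?_)
      rw [χone n x h]
      exact χ1 n y
    · refine IsLocalMin.fderiv_eq_zero (Eventually.of_forall fun y => ?_)
      rw [χzero n x fun h' => hx ⟨h', h⟩]
      exact χ0 n y
  have ηfz : ∀ (n : ℕ) x, x ∉ Metric.thickening (3 * (1 / ((n : ℝ) + 1))) C →
      fderiv ℝ (η n) x = 0 := by
    intro n x hx
    refine IsLocalMin.fderiv_eq_zero (Eventually.of_forall fun y => ?_)
    rw [ηzero n x hx]
    exact η0 n y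
  have hfd : ∀ n x, fderiv ℝ (fun x => χ n x * (1 - η n x)) x =
      χ n x • -fderiv ℝ (η n) x + (1 - η n x) • fderiv ℝ (χ n) x := by
    intro n x
    have dχ : DifferentiableAt ℝ (χ n) x := (hχ n).differentiable (by simp) x
    have dη : DifferentiableAt ℝ (η n) x := (hη n).differentiable (by simp) x
    rw [fderiv_fun_mul dχ (dη.const_sub 1), fderiv_const_sub]
  refine ⟨M, hM, fun n x => χ n x * (1 - η n x), fun n => (hχ n).mul (contDiff_const.sub (hη n)),
    fun n => ?_, fun n => ?_, fun n x => ⟨?_, ?_⟩, fun n x => ?_, fun x hx => ?_⟩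
  · refine HasCompactSupport.intro (isCompact_closedBall (0 : E3) (3 * (n + 1))) fun x hx => ?_
    simp only
    rw [χzero n x fun h => hx (Metric.ball_subset_closedBall h), zero_mul]
  · have h : tsupport (fun x => χ n x * (1 - η n x)) ⊆ (Metric.thickening (1 / (n + 1)) C)ᶜ := by
      refine closure_minimal (fun x hx h => hx ?_) Metric.isOpen_thickening.isClosed_compl
      simp [ηone n x h]
    exact h.trans (compl_subset_compl.2
      (Metric.self_subset_thickening (one_div_pos.2 (hpos n)) C))
  · exact mul_nonneg (χ0 n x) (by linarith [η1 n x])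
  · exact mul_le_one₀ (χ1 n x) (by linarith [η1 n x]) (by linarith [η0 n x])
  · have hχb : ‖fderiv ℝ (χ n) x‖ ≤
        (Metric.ball 0 (3 * (n + 1)) \ Metric.ball (0 : E3) (n + 1)).indicator
          (fun _ => M / (n + 1)) x := by
      by_cases h : x ∈ Metric.ball 0 (3 * ((n : ℝ) + 1)) \ Metric.ball (0 : E3) (n + 1)
      · rw [indicator_of_mem h]
        exact χd n x
      · rw [indicator_of_notMem h, χfz n x h, norm_zero]
    have hηb : ‖fderiv ℝ (η n) x‖ ≤
        (Metric.thickening (3 * (1 / (n + 1))) C).indicator (fun _ => M / (1 / (n + 1))) x := by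
      by_cases h : x ∈ Metric.thickening (3 * (1 / ((n : ℝ) + 1))) C
      · rw [indicator_of_mem h]
        exact ηd n x
      · rw [indicator_of_notMem h, ηfz n x h, norm_zero]
    rw [hfd, add_comm]
    refine (norm_add_le _ _).trans (add_le_add (le_trans ?_ hχb) (le_trans ?_ hηb))
    · rw [norm_smul, Real.norm_of_nonneg (by linarith [η1 n x])]
      exact mul_le_of_le_one_left (norm_nonneg _) (by linarith [η0 n x])
    · rw [norm_smul, norm_neg, Real.norm_of_nonneg (χ0 n x)]
      exact mul_le_of_le_one_left (norm_nonneg _) (χ1 n x)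
  · obtain ⟨δ, hδ, hball⟩ := Metric.isOpen_iff.1 hC.isOpen_compl x hx
    have e1 : ∀ᶠ n : ℕ in atTop, 3 * (1 / ((n : ℝ) + 1)) < δ := by
      have := (tendsto_one_div_add_atTop_nhds_zero_nat (𝕜 := ℝ)).const_mul 3
      rw [mul_zero] at this
      exact this.eventually_lt_const hδ
    have e2 : ∀ᶠ n : ℕ in atTop, ‖x‖ < (n : ℝ) :=
      tendsto_natCast_atTop_atTop.eventually_gt_atTop ‖x‖
    filter_upwards [e1, e2] with n h1 h2
    have hx1 : x ∉ Metric.thickening (3 * (1 / ((n : ℝ) + 1))) C := by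
      intro h
      obtain ⟨s, hs, hxs⟩ := Metric.mem_thickening_iff.1 h
      refine hball (a := s) ?_ hs
      rw [Metric.mem_ball, dist_comm]
      linarith
    have hx2 : x ∈ Metric.ball (0 : E3) (n + 1) := by
      rw [mem_ball_zero_iff]
      linarith
    rw [hfd, χone n x hx2, ηzero n x hx1, ηfz n x hx1, χfz n x fun h => h.2 hx2]
    simp

/-- Cutting off a vector potential near a thin set and at infinity changes its curl by an amount
that stays bounded in `L²`. -/
lemma exists_bound_curl_cutoff {C : Set E3} (hC : IsClosed C) (hthin : IsThin C)
    {ψ : E3 → E3} (hψ : ContDiff ℝ ∞ ψ) {B : ℝ} (hB : 0 ≤ B)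
    (hψB : ∀ x, ‖ψ x‖ ≤ B * (1 + ‖x‖)⁻¹) :
    ∃ (Q : ℝ) (φ : ℕ → E3 → E3), (∀ n, IsTestField Cᶜ (φ n)) ∧
      (∀ n, eLpNorm (φ n - curl ψ) 2 volume ≤ eLpNorm (curl ψ) 2 volume + ENNReal.ofReal Q) ∧
      ∀ x ∉ C, ∀ᶠ n in atTop, φ n x = curl ψ x := by
  obtain ⟨M, hM, θ, hθ, hθc, hθs, hθ01, hθd, hθe⟩ := exists_cutoffs_avoiding C hC
  obtain ⟨D, hD, hvol⟩ := hthin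
  have dψ : Differentiable ℝ ψ := hψ.differentiable (by simp)
  have dθ : ∀ n, Differentiable ℝ (θ n) := fun n => (hθ n).differentiable (by simp)
  set V : ℝ := volume.real (Metric.ball (0 : E3) 1) with hV
  set c : ℝ := 3 * ‖crossL‖ with hc
  have hc0 : 0 ≤ c := by positivity
  refine ⟨c * (M * B) * √(27 * V) + c * (M * B) * √D, fun n => curl fun y => θ n y • ψ y,
    fun n => ?_, fun n => ?_, fun x hx => ?_⟩
  · exact isTestField_curl ((hθ n).smul hψ) ((hθc n).smul_right)
      ((tsupport_smul_subset_left (θ n) ψ).trans (hθs n))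
  · set N : ℝ := n + 1 with hN
    have hN1 : 1 ≤ N := by rw [hN]; linarith [(Nat.cast_nonneg n : (0 : ℝ) ≤ n)]
    have hN0 : 0 < N := by linarith
    -- `f₁` is O(N⁻²) on a ball of volume O(N³); `f₂` is O(N) on a tube of volume O(N⁻²). Both are
    -- bounded in L² uniformly in N, and `f₂` is exactly critical.
    let f₁ : E3 → ℝ := (Metric.ball 0 (3 * N)).indicator fun _ => c * (M / N * (B / N))
    let f₂ : E3 → ℝ := (Metric.thickening (3 * (1 / N)) C).indicator
      fun _ => c * (M / (1 / N) * B)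
    have m₁ : Measurable f₁ := measurable_const.indicator measurableSet_ball
    have m₂ : Measurable f₂ := measurable_const.indicator Metric.isOpen_thickening.measurableSet
    have b₁ : eLpNorm f₁ 2 volume ≤ ENNReal.ofReal (c * (M * B) * √(27 * V)) := by
      refine (eLpNorm_two_le_of_le_indicator (s := Metric.ball 0 (3 * N)) measurableSet_ball
        (c := c * (M / N * (B / N))) (D := (3 * N) ^ 3 * V) (by positivity) (fun x => ?_) ?_).trans
          (ENNReal.ofReal_le_ofReal ?_)
      · rw [Real.norm_of_nonneg (indicator_nonneg (fun _ _ => by positivity) _)]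
      · rw [Measure.addHaar_ball volume _ (by positivity), finrank_euclideanSpace_fin,
          ENNReal.ofReal_mul (by positivity), hV, Measure.real, ENNReal.ofReal_toReal
            measure_ball_lt_top.ne]
      · have h1 : √((3 * N) ^ 3 * V) ≤ √(27 * V) * N ^ 2 := by
          refine Real.sqrt_le_iff.2 ⟨by positivity, ?_⟩
          rw [mul_pow √_, Real.sq_sqrt (by positivity)]
          have h2 : N ^ 3 ≤ (N ^ 2) ^ 2 := by
            rw [← pow_mul]
            exact pow_le_pow_right₀ hN1 (by norm_num)
          have h3 : 0 ≤ V := by positivity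
          calc (3 * N) ^ 3 * V = 27 * V * N ^ 3 := by ring
            _ ≤ _ := by gcongr
        calc c * (M / N * (B / N)) * √((3 * N) ^ 3 * V)
            ≤ c * (M / N * (B / N)) * (√(27 * V) * N ^ 2) := by gcongr
          _ = _ := by field_simp
    have b₂ : eLpNorm f₂ 2 volume ≤ ENNReal.ofReal (c * (M * B) * √D) := by
      refine (eLpNorm_two_le_of_le_indicator Metric.isOpen_thickening.measurableSet
        (c := c * (M / (1 / N) * B)) (D := D * (1 / N) ^ 2) (by positivity) (fun x => ?_)
          (hvol _ (by positivity) ((div_le_one hN0).2 hN1))).trans (le_of_eq ?_)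
      · rw [Real.norm_of_nonneg (indicator_nonneg (fun _ _ => by positivity) _)]
      · rw [Real.sqrt_mul hD, Real.sqrt_sq (by positivity)]
        congr 1
        field_simp
    have hcurl : AEStronglyMeasurable (curl ψ) volume :=
      (contDiff_curl hψ).continuous.aestronglyMeasurable
    have hpt : ∀ x, ‖((curl fun y => θ n y • ψ y) - curl ψ) x‖ ≤
        ‖curl ψ x‖ + (f₁ x + f₂ x) := by
      intro x
      have h1 := norm_curl_smul_sub_le (dθ n x) (dψ x)
      have h2 : ‖(curl fun y => θ n y • ψ y) x - curl ψ x‖ ≤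
          ‖(curl fun y => θ n y • ψ y) x - θ n x • curl ψ x‖ + ‖curl ψ x‖ := by
        have h3 : (curl fun y => θ n y • ψ y) x - curl ψ x =
            ((curl fun y => θ n y • ψ y) x - θ n x • curl ψ x) - (1 - θ n x) • curl ψ x := by
          rw [sub_smul, one_smul]
          abel
        rw [h3]
        refine (norm_sub_le _ _).trans (add_le_add le_rfl ?_)
        rw [norm_smul, Real.norm_of_nonneg (by linarith [(hθ01 n x).2])]
        exact mul_le_of_le_one_left (norm_nonneg _) (by linarith [(hθ01 n x).1])
      have h4 : c * (‖fderiv ℝ (θ n) x‖ * ‖ψ x‖) ≤ f₁ x + f₂ x := by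
        have hd := mul_le_mul_of_nonneg_right (hθd n x) (norm_nonneg (ψ x))
        rw [← hN, add_mul] at hd
        have h5 : (Metric.ball 0 (3 * N) \ Metric.ball (0 : E3) N).indicator
            (fun _ => M / N) x * ‖ψ x‖ * c ≤ f₁ x := by
          by_cases h : x ∈ Metric.ball 0 (3 * N) \ Metric.ball (0 : E3) N
          · have hxN : N ≤ ‖x‖ := by simpa using h.2
            have h6 : ‖ψ x‖ ≤ B / N := by
              refine (hψB x).trans ?_
              rw [div_eq_mul_inv]
              gcongr
              linarith
            rw [indicator_of_mem h, show f₁ x = _ from indicator_of_mem h.1 _, mul_comm _ c]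
            gcongr
          · rw [indicator_of_notMem h, zero_mul, zero_mul]
            exact indicator_nonneg (fun _ _ => by positivity) _
        have h7 : (Metric.thickening (3 * (1 / N)) C).indicator
            (fun _ => M / (1 / N)) x * ‖ψ x‖ * c ≤ f₂ x := by
          by_cases h : x ∈ Metric.thickening (3 * (1 / N)) C
          · have h6 : ‖ψ x‖ ≤ B := by
              refine (hψB x).trans (mul_le_of_le_one_right hB ?_)
              exact inv_le_one_of_one_le₀ (by linarith [norm_nonneg x])
            rw [indicator_of_mem h, show f₂ x = _ from indicator_of_mem h _, mul_comm _ c]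
            gcongr
          · rw [indicator_of_notMem h, zero_mul, zero_mul]
            exact indicator_nonneg (fun _ _ => by positivity) _
        have := mul_le_mul_of_nonneg_right hd hc0
        linarith
      rw [Pi.sub_apply]
      linarith
    refine (eLpNorm_mono_real hpt).trans ?_
    refine (eLpNorm_add_le (g := fun x => f₁ x + f₂ x) hcurl.norm
      (m₁.add m₂).aestronglyMeasurable (by norm_num)).trans ?_
    rw [eLpNorm_norm]
    refine add_le_add le_rfl ((eLpNorm_add_le m₁.aestronglyMeasurable m₂.aestronglyMeasurable
      (by norm_num)).trans ?_)
    rw [ENNReal.ofReal_add (by positivity) (by positivity)]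
    exact add_le_add b₁ b₂
  · filter_upwards [hθe x hx] with n hn
    rw [curl_smul (dθ n x) (dψ x), hn.1, hn.2]
    simp

/-! ### Weak limits and membership in the solenoidal space. -/

/-- A bounded sequence in `L²` whose terms eventually vanish at almost every point converges
weakly to zero. -/
lemma tendsto_inner_zero_of_bounded_of_ae_eventually_zero {α E : Type*} [MeasurableSpace α]
    [NormedAddCommGroup E] [InnerProductSpace ℝ E] {μ : Measure α} (g : Lp E 2 μ)
    (F : ℕ → Lp E 2 μ) {Q : ℝ} (hQ : ∀ n, ‖F n‖ ≤ Q)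
    (h0 : ∀ᵐ x ∂μ, ∀ᶠ n in atTop, F n x = 0) :
    Tendsto (fun n => inner ℝ g (F n)) atTop (𝓝 0) := by
  have hms : ∀ n, MeasurableSet (Function.support (F n)) := fun n =>
    (Lp.stronglyMeasurable (F n)).measurableSet_support
  have hG : ∀ n, MemLp ((Function.support (F n)).indicator g) 2 μ := fun n =>
    (Lp.memLp g).indicator (hms n)
  -- Only the part of `g` on the support of `F n` contributes to the inner product. It tends to 0 in
  -- norm by dominated convergence, and Cauchy–Schwarz against the bound `Q` concludes.
  let G : ℕ → Lp E 2 μ := fun n => (hG n).toLp _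
  have hGae : ∀ n, G n =ᵐ[μ] (Function.support (F n)).indicator g := fun n => (hG n).coeFn_toLp
  have hinner : ∀ n, inner ℝ g (F n) = inner ℝ (G n) (F n) := by
    intro n
    rw [L2.inner_def, L2.inner_def]
    refine integral_congr_ae ?_
    filter_upwards [hGae n] with x hx
    rw [hx]
    by_cases h : x ∈ Function.support (F n)
    · rw [indicator_of_mem h]
    · rw [Function.notMem_support.1 h, inner_zero_right, inner_zero_right]
  have hsq : Tendsto (fun n => ‖G n‖ ^ 2) atTop (𝓝 0) := by
    have h1 : ∀ n, ‖G n‖ ^ 2 = ∫ x, inner ℝ (G n x) (G n x) ∂μ := fun n => by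
      rw [← L2.inner_def, real_inner_self_eq_norm_sq]
    simp only [h1]
    rw [← integral_zero α ℝ (μ := μ)]
    refine tendsto_integral_of_dominated_convergence (fun x => ‖inner ℝ (g x) (g x)‖)
      (fun n => (L2.integrable_inner (𝕜 := ℝ) (G n) (G n)).aestronglyMeasurable)
      (L2.integrable_inner (𝕜 := ℝ) g g).norm (fun n => ?_) ?_
    · filter_upwards [hGae n] with x hx
      rw [hx]
      by_cases h : x ∈ Function.support (F n)
      · rw [indicator_of_mem h]
      · rw [indicator_of_notMem h, inner_zero_right, norm_zero]
        exact norm_nonneg _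
    · filter_upwards [h0, ae_all_iff.2 hGae] with x hx hGx
      refine tendsto_const_nhds.congr' ?_
      filter_upwards [hx] with n hn
      rw [hGx n, indicator_of_notMem (Function.notMem_support.2 hn), inner_zero_right]
  have hGn : Tendsto (fun n => ‖G n‖ * Q) atTop (𝓝 0) := by
    have := (hsq.sqrt).mul_const Q
    simpa [Real.sqrt_sq (norm_nonneg _)] using this
  refine squeeze_zero_norm (fun n => ?_) hGn
  rw [hinner]
  exact (norm_inner_le_norm _ _).trans (mul_le_mul_of_nonneg_left (hQ n) (norm_nonneg _))

/-- A curl with a decaying potential is a limit of test fields supported away from a thin set. -/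
lemma restrictL2_curl_mem_solenoidal {C : Set E3} (hC : IsClosed C) (hthin : IsThin C)
    {ψ : E3 → E3} (hψ : ContDiff ℝ ∞ ψ) {B : ℝ} (hB : 0 ≤ B)
    (hψB : ∀ x, ‖ψ x‖ ≤ B * (1 + ‖x‖)⁻¹) (hv : MemLp (curl ψ) 2 volume) :
    restrictL2 Cᶜ hv ∈ solenoidal Cᶜ := by
  obtain ⟨Q, φ, hφ, hφb, hφe⟩ := exists_bound_curl_cutoff hC hthin hψ hB hψB
  have hφL : ∀ n, MemLp (φ n) 2 volume := fun n =>
    (hφ n).contDiff.continuous.memLp_of_hasCompactSupport (hφ n).hasCompactSupport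
  -- The closure is the double orthogonal complement. For `g` orthogonal to all test fields, the
  -- inner product of `g` with `F n` is a constant independent of `n`; weak convergence to 0 makes
  -- that constant zero.
  rw [solenoidal, ← Submodule.orthogonal_orthogonal_eq_closure, Submodule.mem_orthogonal]
  intro g hg
  let F : ℕ → L2Field Cᶜ := fun n => restrictL2 Cᶜ (hφL n) - restrictL2 Cᶜ hv
  have hmem : ∀ n, restrictL2 Cᶜ (hφL n) ∈ testFieldsL2 Cᶜ := fun n =>
    ⟨φ n, hφ n, MemLp.coeFn_toLp _⟩
  have hF : ∀ n, F n = (((hφL n).sub hv).restrict Cᶜ).toLp _ := fun n => rfl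
  have hinner : ∀ n, inner ℝ g (F n) = -inner ℝ g (restrictL2 Cᶜ hv) := fun n => by
    rw [inner_sub_right, (Submodule.mem_orthogonal' _ g).1 hg _ (hmem n), zero_sub]
  have hlim : Tendsto (fun n => inner ℝ g (F n)) atTop (𝓝 0) := by
    refine tendsto_inner_zero_of_bounded_of_ae_eventually_zero g F
      (Q := (eLpNorm (curl ψ) 2 volume + ENNReal.ofReal Q).toReal) (fun n => ?_) ?_
    · rw [hF, Lp.norm_toLp]
      refine ENNReal.toReal_mono ?_ ((eLpNorm_restrict_le _ _ _ _).trans (hφb n))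
      exact ENNReal.add_ne_top.2 ⟨hv.eLpNorm_ne_top, ENNReal.ofReal_ne_top⟩
    · have hae : ∀ᵐ x ∂(volume.restrict Cᶜ), ∀ n, F n x = (φ n - curl ψ) x :=
        ae_all_iff.2 fun n => MemLp.coeFn_toLp (((hφL n).sub hv).restrict Cᶜ)
      filter_upwards [hae, ae_restrict_mem hC.measurableSet.compl] with x hx hxC
      filter_upwards [hφe x hxC] with n hn
      rw [hx, Pi.sub_apply, hn, sub_self]
  simp only [hinner] at hlim
  exact neg_eq_zero.1 (tendsto_nhds_unique tendsto_const_nhds hlim)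

/-- A thin set is null, so the norm on its complement is the norm on the whole space. -/
lemma exists_testField_eLpNorm_sub_lt {C : Set E3} (hthin : IsThin C) {v : E3 → E3}
    (hv : MemLp v 2 volume) (h : restrictL2 Cᶜ hv ∈ solenoidal Cᶜ) {ε : ℝ≥0∞} (hε : 0 < ε) :
    ∃ φ, IsTestField Cᶜ φ ∧ eLpNorm (φ - v) 2 volume < ε := by
  -- The minimum with 1 covers `ε = ⊤`, for which `toReal` would return 0.
  obtain ⟨f, ⟨φ, hφ, hfφ⟩, hf⟩ := Metric.mem_closure_iff.1 h (min ε 1).toReal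
    (ENNReal.toReal_pos (by simp [hε.ne']) (by simp))
  refine ⟨φ, hφ, lt_of_lt_of_le ?_ (min_le_left ε 1)⟩
  have hφL : MemLp φ 2 volume :=
    hφ.contDiff.continuous.memLp_of_hasCompactSupport hφ.hasCompactSupport
  have hres : volume.restrict Cᶜ = (volume : Measure E3) :=
    Measure.restrict_eq_self_of_ae_mem (compl_mem_ae_iff.2 hthin.volume_eq_zero)
  have hfe : f - restrictL2 Cᶜ hv = ((hφL.sub hv).restrict Cᶜ).toLp _ := by
    rw [MemLp.toLp_sub (hφL.restrict Cᶜ) (hv.restrict Cᶜ)]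
    congr 1
    refine Lp.ext (hfφ.trans ?_)
    exact (MemLp.coeFn_toLp (hφL.restrict Cᶜ)).symm
  rw [dist_comm, dist_eq_norm, hfe, Lp.norm_toLp, hres] at hf
  exact (ENNReal.toReal_lt_toReal (hφL.sub hv).eLpNorm_ne_top (by simp)).1 hf

/-! ### Passage to the obstacles. -/

/-- The Leray projection is at most as far from a field as twice any test field. -/
lemma eLpNorm_extendByZero_lerayProjection_sub_le {K : Set E3} (hK : IsClosed K) {v : E3 → E3}
    (hv : MemLp v 2 volume) {φ : E3 → E3} (hφ : IsTestField Kᶜ φ) :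
    eLpNorm (extendByZero Kᶜ (lerayProjection Kᶜ (restrictL2 Kᶜ hv)) - v) 2 volume ≤
      eLpNorm (φ - v) 2 volume + eLpNorm (φ - v) 2 volume := by
  set u : L2Field Kᶜ := ((lerayProjection Kᶜ (restrictL2 Kᶜ hv) : solenoidal Kᶜ) : L2Field Kᶜ)
  have hms : MeasurableSet Kᶜ := hK.measurableSet.compl
  have hφL : MemLp φ 2 volume :=
    hφ.contDiff.continuous.memLp_of_hasCompactSupport hφ.hasCompactSupport
  have hmem : restrictL2 Kᶜ hφL ∈ solenoidal Kᶜ :=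
    (testFieldsL2 Kᶜ).le_topologicalClosure ⟨φ, hφ, MemLp.coeFn_toLp _⟩
  have hmin : ‖restrictL2 Kᶜ hv - u‖ ≤ ‖restrictL2 Kᶜ hv - restrictL2 Kᶜ hφL‖ := by
    have h1 : ‖restrictL2 Kᶜ hv - u‖ = ⨅ x : solenoidal Kᶜ, ‖restrictL2 Kᶜ hv - x‖ :=
      Submodule.starProjection_minimal _
    rw [h1]
    exact ciInf_le ⟨0, by rintro _ ⟨x, rfl⟩; exact norm_nonneg _⟩
      (⟨_, hmem⟩ : solenoidal Kᶜ)
  have hu_le : eLpNorm (⇑u - v) 2 (volume.restrict Kᶜ) ≤ eLpNorm (φ - v) 2 volume := by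
    have e1 : eLpNorm (⇑u - v) 2 (volume.restrict Kᶜ) =
        eLpNorm (⇑(u - restrictL2 Kᶜ hv)) 2 (volume.restrict Kᶜ) := by
      refine eLpNorm_congr_ae ?_
      exact ((Lp.coeFn_sub _ _).trans
        ((EventuallyEq.refl _ _).sub (MemLp.coeFn_toLp (hv.restrict Kᶜ)))).symm
    have e2 : restrictL2 Kᶜ hφL - restrictL2 Kᶜ hv = ((hφL.sub hv).restrict Kᶜ).toLp _ := rfl
    rw [norm_sub_rev, norm_sub_rev _ (restrictL2 Kᶜ hφL), e2, Lp.norm_toLp, Lp.norm_def,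
      ENNReal.toReal_le_toReal (Lp.eLpNorm_ne_top _)
        ((hφL.sub hv).restrict Kᶜ).eLpNorm_ne_top] at hmin
    rw [e1]
    exact hmin.trans (eLpNorm_restrict_le _ _ _ _)
  -- On `K` the extension and φ both vanish, so the error -v there can be written as φ - v.
  have hsplit : extendByZero Kᶜ u - v = Kᶜ.indicator (⇑u - v) + K.indicator (φ - v) := by
    ext1 x
    by_cases hx : x ∈ K
    · have hφx : φ x = 0 := by
        by_contra h
        exact hφ.tsupport_subset (subset_tsupport φ h) hx
      simp [extendByZero, hx, hφx]
    · simp [extendByZero, hx]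
  rw [hsplit]
  refine (eLpNorm_add_le ?_ ?_ (by norm_num)).trans (add_le_add ?_ (eLpNorm_indicator_le _))
  · exact (aestronglyMeasurable_indicator_iff hms).2
      ((Lp.aestronglyMeasurable u).sub hv.aestronglyMeasurable.restrict)
  · exact (hφL.sub hv).aestronglyMeasurable.indicator hK.measurableSet
  · rw [eLpNorm_indicator_eq_eLpNorm_restrict hms]
    exact hu_le

lemma IsInjectiveC2Curve.isCompact {C : Set E3} (hC : IsInjectiveC2Curve C) : IsCompact C := by
  obtain ⟨a, b, γ, -, hγ, -, -, rfl⟩ := hC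
  exact isCompact_Icc.image_of_continuousOn hγ.continuousOn

lemma IsInjectiveC2Curve.nonempty {C : Set E3} (hC : IsInjectiveC2Curve C) : C.Nonempty := by
  obtain ⟨a, b, γ, hab, -, -, -, rfl⟩ := hC
  exact (nonempty_Icc.2 hab.le).image γ

lemma IsInjectiveC2Curve.isThin {C : Set E3} (hC : IsInjectiveC2Curve C) : IsThin C := by
  obtain ⟨a, b, γ, hab, hγ, -, -, rfl⟩ := hC
  obtain ⟨L, hL⟩ := hγ.exists_lipschitzOnWith (by simp) (convex_Icc a b) isCompact_Icc
  exact exists_volume_thickening_le hab hL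

/-- A test field avoiding a compact set avoids all sets close enough to it. -/
lemma IsTestField.eventually_of_tendsto_hausdorffDist {C : Set E3} (hC : IsCompact C)
    (hne : C.Nonempty) {K : ℕ → Set E3} (hK : ∀ n, IsCompact (K n)) (hCK : ∀ n, C ⊆ K n)
    (hlim : Tendsto (fun n => Metric.hausdorffDist (K n) C) atTop (𝓝 0))
    {φ : E3 → E3} (hφ : IsTestField Cᶜ φ) : ∀ᶠ n in atTop, IsTestField (K n)ᶜ φ := by
  obtain ⟨δ, hδ, hsub⟩ := hC.exists_thickening_subset_open
    (isClosed_tsupport φ).isOpen_compl (subset_compl_comm.1 hφ.tsupport_subset)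
  filter_upwards [hlim.eventually_lt_const hδ] with n hn
  refine ⟨hφ.contDiff, hφ.hasCompactSupport, subset_compl_comm.1 fun x hx => hsub ?_,
    hφ.divergence_eq_zero⟩
  -- A small `hausdorffDist` carries information only if the extended distance is finite, since its
  -- default value is 0; nonemptiness and boundedness ensure this.
  exact Metric.mem_thickening_iff.2 (Metric.exists_dist_lt_of_hausdorffDist_lt hx hn
    (Metric.hausdorffEDist_ne_top_of_nonempty_of_bounded (hne.mono (hCK n)) hne
      (hK n).isBounded hC.isBounded))

end ThinObstacle

end

theorem mainTheorem3 (C : Set ThinObstacle.E3) (hC : ThinObstacle.IsInjectiveC2Curve C)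
    (K : ℕ → Set ThinObstacle.E3) (hK : ∀ n, ThinObstacle.IsSmoothObstacle (K n))
    (hCK : ∀ n, C ⊆ K n)
    (hlim : Tendsto (fun n => Metric.hausdorffDist (K n) C) atTop (𝓝 0))
    (ω₀ : ThinObstacle.E3 → ThinObstacle.E3) (hω₀ : ThinObstacle.IsTestField univ ω₀) :
    ∃ hv : MemLp (ThinObstacle.biotSavart ω₀) 2 volume,
      Tendsto
        (fun n => eLpNorm
          (ThinObstacle.extendByZero (K n)ᶜ
              (ThinObstacle.lerayProjection (K n)ᶜ (ThinObstacle.restrictL2 (K n)ᶜ hv))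
            - ThinObstacle.biotSavart ω₀) 2 volume)
        atTop (𝓝 0) := by
  have hw := hω₀.contDiff
  have hc := hω₀.hasCompactSupport
  obtain ⟨B, hB, hψB⟩ := ThinObstacle.exists_vectorPotential_bound hw hc
  have hcurl := ThinObstacle.curl_vectorPotential hw hc
  have hv := ThinObstacle.memLp_biotSavart hw hc
  refine ⟨hv, ENNReal.tendsto_nhds_zero.2 fun ε hε => ?_⟩
  have hmem : ThinObstacle.restrictL2 Cᶜ hv ∈ ThinObstacle.solenoidal Cᶜ := by
    have hv' := hv
    rw [← hcurl] at hv'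
    have h := ThinObstacle.restrictL2_curl_mem_solenoidal hC.isCompact.isClosed hC.isThin
      (ThinObstacle.contDiff_vectorPotential hw hc) hB hψB hv'
    simpa only [hcurl] using h
  -- Half of ε, because the error counts ‖φ - v‖ twice: once off the obstacle and once on it.
  obtain ⟨φ, hφ, hφε⟩ := ThinObstacle.exists_testField_eLpNorm_sub_lt hC.isThin hv hmem
    (ENNReal.half_pos hε.ne')
  filter_upwards [hφ.eventually_of_tendsto_hausdorffDist hC.isCompact hC.nonempty
    (fun n => (hK n).isCompact) hCK hlim] with n hn
  refine (ThinObstacle.eLpNorm_extendByZero_lerayProjection_sub_le (hK n).isCompact.isClosed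
    hv hn).trans ?_
  exact (add_le_add hφε.le hφε.le).trans (ENNReal.add_halves ε).le
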